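/- Let $n \ge 2$ and $[n] = \{0, \dots, n-1\}$. Given a list $x = (x_0, \dots, x_{n-1})$ of elements of a totally ordered set, a single step of the \emph{harmonic sorter} picks, independently of all other steps, an unordered pair $\{i,j\} \subseteq [n]$, $i \ne j$, with probability $$\frac{1/|j-i|}{\sum_{0 \le k < \ell \le n-1} 1/|\ell-k|},$$ and sorts the entries at the positions $i<j$: they are swapped if the entry at position $i$ is larger than the entry at position $j$, and nothing is done otherwise. Let $\tau(x) \in \{0,1,2,\dots\} \cup \{\infty\}$ be the number of steps (comparisons) until the list, started from $x$, is first in non-decreasing order. Theorem. The harmonic sorter requires order $n (\log n)^2$ comparisons to sort a length-$n$ list in the worst case, both in expectation and with polynomially small failure probability. That is: 1. There is a constant $K > 0$ such that for every $n \ge 2$ and every length-$n$ list $x$ over any totally ordered set (repeated entries allowed), $\mathbb{E}[\tau(x)] \le K n (\log n)^2$. 2. For every $A > 0$ there is a constant $K > 0$ such that for every $n \ge 2$ and every such length-$n$ list $x$, $\mathbb{P}(\tau(x) > K n (\log n)^2) \le n^{-A}$. 3. There are a constant $c > 0$ and, for every $n$, a permutation $x^{(n)}$ of $[n]$ such that $\mathbb{E}[\tau(x^{(n)})]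 \ge c\, n (\log n)^2$ for all $n \ge 2$ and such that, for every $A > 0$, $\mathbb{P}(\tau(x^{(n)}) \le c\, n (\log n)^2) \le n^{-A}$ for all sufficiently large $n$. -/

import Mathlib

open MeasureTheory Filter
open scoped ENNReal NNReal

namespace RandomSorter

/-- The unordered pairs `{i, j}` of distinct positions in `[n] = {0, …, n - 1}`, each represented
by its increasing enumeration `(i, j)`, `i < j`. -/
abbrev Pair (n : ℕ) : Type := {p : Fin n × Fin n // p.1 < p.2}

/-- Sort the entries of the list `x` at the positions `i < j` of the pair `e = {i, j}`: swap them
if the entry at `i` is larger than the entry at `j`, and do nothing otherwise. -/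
def sortPair {n : ℕ} {α : Type*} [LinearOrder α] (e : Pair n) (x : Fin n → α) : Fin n → α :=
  if x e.1.2 < x e.1.1 then x ∘ Equiv.swap e.1.1 e.1.2 else x

/-- The list after `t` steps, started from `x`, when the pair sorted in step `s + 1` is `ω s`. -/
def state {n : ℕ} {α : Type*} [LinearOrder α] (x : Fin n → α) (ω : ℕ → Pair n) :
    ℕ → Fin n → α
  | 0 => x
  | t + 1 => sortPair (ω t) (state x ω t)

/-- The number of comparisons needed to sort `x`: the first time at which the list is sorted
(in non-decreasing order), and `⊤` if there is no such time. -/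
noncomputable def sortingTime {n : ℕ} {α : Type*} [LinearOrder α] (x : Fin n → α)
    (ω : ℕ → Pair n) : ℕ∞ :=
  ⨅ (t : ℕ) (_ : Monotone (state x ω t)), (t : ℕ∞)

/-- The law of a single pair in the randomised sorter driven by the (not identically zero)
weights `w`: the pair `e` has probability `w e / ∑ e', w e'`. -/
noncomputable def pairLaw {n : ℕ} (w : Pair n → ℝ≥0) (hw : w ≠ 0) : PMF (Pair n) :=
  PMF.normalize (fun e => (w e : ℝ≥0∞))
    (fun h => hw (funext fun e => by simpa using ENNReal.tsum_eq_zero.1 h e))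
    (by rw [tsum_fintype]; exact ENNReal.sum_ne_top.2 fun _ _ => ENNReal.coe_ne_top)

/-- The law of the sequence of pairs chosen by the randomised sorter with weights `w`: the pairs
are independent, each with law `pairLaw w hw`. -/
noncomputable def sorterLaw {n : ℕ} (w : Pair n → ℝ≥0) (hw : w ≠ 0) : Measure (ℕ → Pair n) :=
  Measure.infinitePi fun _ : ℕ => (pairLaw w hw).toMeasure

/-- The harmonic weights `w {i, j} = 1 / |j - i|`; as `i < j`, the subtraction of natural numbers
is `|j - i|`. -/
noncomputable def harmonicWeight (n : ℕ) (e : Pair n) : ℝ≥0 :=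
  1 / (((e.1.2 : ℕ) - (e.1.1 : ℕ) : ℕ) : ℝ≥0)

theorem harmonicWeight_ne_zero {n : ℕ} (hn : 2 ≤ n) : harmonicWeight n ≠ 0 := by
  intro h
  have h1 := congrFun h ⟨(⟨0, by omega⟩, ⟨1, by omega⟩), by simp [Fin.lt_def]⟩
  simp [harmonicWeight] at h1

/-- The law of the sequence of pairs chosen by the harmonic sorter. -/
noncomputable def harmonicLaw (n : ℕ) (hn : 2 ≤ n) : Measure (ℕ → Pair n) :=
  sorterLaw (harmonicWeight n) (harmonicWeight_ne_zero hn)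

end RandomSorter

/-! Upper bound. By the 0-1 principle it suffices to follow, for each threshold `v` among the
entries, the 0/1 list recording which entries exceed `v`. Moving a 1 from position `i` past a 0 at
`j > i` lowers its number of inversions by exactly `j - i` (`inversions_sortPair`). The weight `1 /
(j - i)` cancels this gain, so each inverted pair contributes the same expected decrease. With `W`
the total weight, the expected number of inversions is thus multiplied by exactly `1 - 1 / W` per
step (`sum_harmonicWeight_mul_inversions`). It starts at most at `n ^ 2`; Markov and a union bound
over `n` thresholds give `n ^ 3 * (1 - 1 / W) ^ t` as a bound on the probability of being unsorted
at time `t` (`measure_not_monotone_le`). Since `W` has order `n log n`, order `W log n` steps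
suffice.

Lower bound. Take the permutation exchanging `2 k` and `2 k + 1` for every `k`. Comparisons between
different blocks never swap anything, so each of the `⌊n / 2⌋` adjacent pairs has to be drawn
itself, each with probability `1 / W` per step. This is a coupon collector problem
(`infinitePi_collect_le`), which takes order `W log n` steps. -/

namespace RandomSorter

/-! ### Independent sequences: splitting off the first term, and the coupon collector bound. -/

section Shift

variable {E : Type*}

/-- The sequence `e, ω 0, ω 1, …`. -/
def seqCons (e : E) (ω : ℕ → E) : ℕ → E
  | 0 => e
  | k + 1 => ω k

theorem measurable_seqCons [MeasurableSpace E] :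
    Measurable fun q : E × (ℕ → E) => seqCons q.1 q.2 := by
  refine measurable_pi_lambda _ fun k => ?_
  cases k with
  | zero => exact measurable_fst
  | succ k => exact (measurable_pi_apply k).comp measurable_snd

variable [MeasurableSpace E]

/-- The infinite product measure on sequences is the law of an independent first term followed by
an independent copy of the sequence. -/
theorem map_cons_infinitePi (μ : Measure E) [IsProbabilityMeasure μ] :
    Measure.map (fun q : E × (ℕ → E) => seqCons q.1 q.2)
      (μ.prod (Measure.infinitePi fun _ : ℕ => μ)) = Measure.infinitePi fun _ : ℕ => μ := by
  refine Measure.eq_infinitePi _ fun s t ht => ?_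
  classical
  rw [Measure.map_apply measurable_seqCons (MeasurableSet.pi s.countable_toSet fun i _ => ht i)]
  -- Padding with `univ` turns the cylinder over `s` into one over an initial segment, from which
  -- coordinate 0 splits off.
  let u : ℕ → Set E := fun k => if k ∈ s then t k else Set.univ
  have hu : ∀ k, MeasurableSet (u k) := fun k => by
    by_cases hk : k ∈ s
    · simpa [u, hk] using ht k
    · simp [u, hk]
  obtain ⟨N, hN⟩ : ∃ N, s ⊆ Finset.range (N + 1) :=
    ⟨s.sup id, fun k hk => Finset.mem_range.2 (Nat.lt_succ_of_le (Finset.le_sup (f := id) hk))⟩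
  have hpre : (fun q : E × (ℕ → E) => seqCons q.1 q.2) ⁻¹'
      Set.pi s t = u 0 ×ˢ Set.pi (Finset.range N) fun k => u (k + 1) := by
    ext ⟨a, ω⟩
    simp only [Set.mem_preimage, Set.mem_pi, Finset.mem_coe, Set.mem_prod, Finset.mem_range]
    constructor
    · intro h
      refine ⟨?_, fun k _ => ?_⟩
      · by_cases h0 : 0 ∈ s
        · simpa [u, h0, seqCons] using h 0 h0
        · simp [u, h0]
      · by_cases h0 : k + 1 ∈ s
        · simpa [u, h0, seqCons] using h _ h0
        · simp [u, h0]
    · rintro ⟨h0, h⟩ k hk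
      cases k with
      | zero => simpa [u, hk, seqCons] using h0
      | succ k =>
        have := h k (by have := Finset.mem_range.1 (hN hk); omega)
        simpa [u, hk, seqCons] using this
  rw [hpre, Measure.prod_prod, Measure.infinitePi_pi _ fun k _ => hu (k + 1), mul_comm,
    ← Finset.prod_range_succ' (fun k => μ (u k)) N, ← Finset.prod_subset hN]
  · exact Finset.prod_congr rfl fun k hk => by simp [u, hk]
  · intro k _ hk
    simp [u, hk]

theorem lintegral_infinitePi_cons [Fintype E] [MeasurableSingletonClass E] (p : PMF E)
    {f : (ℕ → E) → ℝ≥0∞} (hf : Measurable f) :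
    ∫⁻ ω, f ω ∂(Measure.infinitePi fun _ : ℕ => p.toMeasure) =
      ∑ e, p e * ∫⁻ ω, f (seqCons e ω)
        ∂(Measure.infinitePi fun _ : ℕ => p.toMeasure) := by
  conv_lhs => rw [← map_cons_infinitePi p.toMeasure]
  rw [lintegral_map hf measurable_seqCons,
    lintegral_prod (fun q : E × (ℕ → E) => f (seqCons q.1 q.2))
    (hf.comp measurable_seqCons).aemeasurable, lintegral_fintype]
  refine Finset.sum_congr rfl fun e _ => ?_
  rw [PMF.toMeasure_apply_singleton _ _ (measurableSet_singleton e), mul_comm]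

/-- Coupon collector: the probability that `T` independent samples hit all elements of a set
of points of mass `q`. -/
theorem infinitePi_collect_le [Fintype E] [DecidableEq E] [MeasurableSingletonClass E] (p : PMF E)
    {q : ℝ} (hq : 0 ≤ q) (T : ℕ) (F : Finset E) (hF : ∀ e ∈ F, p e = ENNReal.ofReal q) :
    (Measure.infinitePi fun _ : ℕ => p.toMeasure) {ω | ∀ e ∈ F, ∃ s < T, ω s = e} ≤
      ENNReal.ofReal ((1 - (1 - q) ^ T) ^ F.card) := by
  classical
  -- Needed so that `1 - F.card * q`, the mass outside `F`, is nonnegative.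
  have hq1 : ∀ (F : Finset E), (∀ e ∈ F, p e = ENNReal.ofReal q) → F.card * q ≤ 1 := by
    intro F hF
    have h1 : ∑ e ∈ F, p e ≤ 1 := by
      rw [← p.tsum_coe]
      exact ENNReal.sum_le_tsum F
    rw [Finset.sum_congr rfl hF, Finset.sum_const, nsmul_eq_mul, ← ENNReal.ofReal_natCast,
      ← ENNReal.ofReal_mul (by positivity)] at h1
    exact ENNReal.ofReal_le_one.1 h1
  have hms : ∀ (T : ℕ) (F : Finset E),
      MeasurableSet {ω : ℕ → E | ∀ e ∈ F, ∃ s < T, ω s = e} := by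
    intro T F
    have : {ω : ℕ → E | ∀ e ∈ F, ∃ s < T, ω s = e} =
        ⋂ e ∈ F, ⋃ s ∈ Finset.range T, (fun ω : ℕ → E => ω s) ⁻¹' {e} := by
      ext ω; simp
    rw [this]
    exact Finset.measurableSet_biInter _ fun e _ => Finset.measurableSet_biUnion _ fun s _ =>
      measurable_pi_apply s (measurableSet_singleton e)
  induction T generalizing F with
  | zero =>
    rcases F.eq_empty_or_nonempty with rfl | h
    · simp
    · have : {ω : ℕ → E | ∀ e ∈ F, ∃ s < 0, ω s = e} = ∅ := by
        obtain ⟨e, he⟩ := h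
        ext ω
        simp only [not_lt_zero, false_and, exists_false, Set.mem_ofPred_eq, Set.mem_empty_iff_false,
          iff_false]
        exact fun h => h e he
      rw [this]; simp
  | succ T ih =>
    rcases F.eq_empty_or_nonempty with rfl | hne
    · simp
    have hq1' : q ≤ 1 := by
      obtain ⟨e, he⟩ := hne
      simpa using hq1 {e} (by simpa using hF e he)
    set a : ℝ := 1 - (1 - q) ^ T with ha
    have ha0 : 0 ≤ a := sub_nonneg.2 (pow_le_one₀ (by linarith) (by linarith))
    have ha1 : a ≤ 1 := by
      have : 0 ≤ (1 - q) ^ T := pow_nonneg (by linarith) _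
      linarith
    rw [← lintegral_indicator_one (hms _ _), lintegral_infinitePi_cons p
      (measurable_one.indicator (hms _ _))]
    -- Condition on the first sample `e`: the remaining `T` samples have to collect `F.erase e`.
    have hstep : ∀ e : E, ∫⁻ ω, Set.indicator {ω : ℕ → E | ∀ e ∈ F, ∃ s < T + 1, ω s = e} 1
        (seqCons e ω)
        ∂(Measure.infinitePi fun _ : ℕ => p.toMeasure) ≤
        ENNReal.ofReal (a ^ (F.erase e).card) := by
      intro e
      refine le_trans (le_of_eq ?_) (ih (F.erase e) fun e' he' =>
        hF e' (Finset.mem_of_mem_erase he'))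
      rw [← lintegral_indicator_one (hms _ _)]
      congr 1
      ext ω
      refine Set.indicator_eq_indicator ?_ rfl
      simp only [Set.mem_ofPred_eq, Finset.mem_erase]
      constructor
      · rintro h e' ⟨hne, he'⟩
        obtain ⟨s, hs, hse⟩ := h e' he'
        cases s with
        | zero => exact absurd hse.symm hne
        | succ s => exact ⟨s, by omega, hse⟩
      · intro h e' he'
        by_cases hne : e' = e
        · exact ⟨0, by omega, hne.symm⟩
        · obtain ⟨s, hs, hse⟩ := h e' ⟨hne, he'⟩
          exact ⟨s + 1, by omega, hse⟩
    refine (Finset.sum_le_sum fun e _ => mul_le_mul_right (hstep e) (p e)).trans ?_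
    have hcard : 1 ≤ F.card := hne.card_pos
    have hsplit : ∑ e, p e * ENNReal.ofReal (a ^ (F.erase e).card) =
        ENNReal.ofReal (F.card * q * a ^ (F.card - 1) + (1 - F.card * q) * a ^ F.card) := by
      rw [← Finset.sum_add_sum_compl F]
      have h1 : ∑ e ∈ F, p e * ENNReal.ofReal (a ^ (F.erase e).card) =
          ENNReal.ofReal (F.card * q * a ^ (F.card - 1)) := by
        rw [Finset.sum_congr rfl fun e he => by rw [hF e he, Finset.card_erase_of_mem he],
          Finset.sum_const, nsmul_eq_mul, ← ENNReal.ofReal_natCast, ← ENNReal.ofReal_mul hq,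
          ← ENNReal.ofReal_mul (by positivity), mul_assoc]
      have h2 : ∑ e ∈ Fᶜ, p e * ENNReal.ofReal (a ^ (F.erase e).card) =
          ENNReal.ofReal ((1 - F.card * q) * a ^ F.card) := by
        rw [Finset.sum_congr rfl fun e he => by
          rw [Finset.erase_eq_of_notMem (Finset.mem_compl.1 he)], ← Finset.sum_mul,
          ENNReal.ofReal_mul (by linarith [hq1 F hF])]
        congr 1
        have h3 : ∑ e ∈ F, p e + ∑ e ∈ Fᶜ, p e = 1 := by
          rw [Finset.sum_add_sum_compl, ← tsum_fintype (L := .unconditional E), p.tsum_coe]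
        have h4 : ∑ e ∈ F, p e = ENNReal.ofReal (F.card * q) := by
          rw [Finset.sum_congr rfl hF, Finset.sum_const, nsmul_eq_mul, ← ENNReal.ofReal_natCast,
            ← ENNReal.ofReal_mul (by positivity)]
        rw [ENNReal.ofReal_sub _ (by positivity), ENNReal.ofReal_one, ← h4]
        exact ENNReal.eq_sub_of_add_eq (by rw [h4]; exact ENNReal.ofReal_ne_top)
          (by rw [add_comm]; exact h3)
      rw [h1, h2, ENNReal.ofReal_add (by positivity)
        (mul_nonneg (by linarith [hq1 F hF]) (by positivity))]
    rw [hsplit]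
    refine ENNReal.ofReal_le_ofReal ?_
    have hnext : 1 - (1 - q) ^ (T + 1) = a + (1 - a) * q := by rw [ha]; ring
    rw [hnext]
    obtain ⟨m, hm⟩ : ∃ m, F.card = m + 1 := ⟨F.card - 1, by omega⟩
    rw [hm, Nat.add_sub_cancel]
    -- The first two terms of the binomial expansion bound the power from below, all terms being
    -- nonnegative.
    have key : ∀ m : ℕ, a ^ (m + 1) + (m + 1) * a ^ m * ((1 - a) * q) ≤
        (a + (1 - a) * q) ^ (m + 1) := by
      intro m
      have hb : 0 ≤ (1 - a) * q := mul_nonneg (by linarith) hq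
      induction m with
      | zero => simp
      | succ m ihm =>
        have := mul_le_mul_of_nonneg_left ihm (add_nonneg ha0 hb)
        rw [← pow_succ'] at this
        refine le_trans ?_ this
        have h5 : 0 ≤ (m + 1) * a ^ m * ((1 - a) * q) * ((1 - a) * q) := by positivity
        push_cast
        linear_combination h5
    refine le_trans (le_of_eq ?_) (key m)
    push_cast
    ring

end Shift


/-! ### The sorting process, its hitting time, and inversions across a threshold. -/

section State

variable {n : ℕ} {α : Type*} [LinearOrder α]

theorem state_cons (x : Fin n → α) (e : Pair n) (ω : ℕ → Pair n) (t : ℕ) :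
    state x (seqCons e ω) (t + 1) =
      state (sortPair e x) ω t := by
  induction t with
  | zero => rfl
  | succ t ih => rw [state, ih]; rfl

theorem exists_state_eq (x : Fin n → α) (ω : ℕ → Pair n) (t : ℕ) (i : Fin n) :
    ∃ k, state x ω t i = x k := by
  induction t generalizing i with
  | zero => exact ⟨i, rfl⟩
  | succ t ih =>
    rw [state, sortPair]
    split_ifs
    · exact ih _
    · exact ih i

/-- The type `α` carries no σ-algebra, so lists get the discrete one; `sortPair` is still jointly
measurable because there are only countably many pairs. -/
theorem measurable_comp_state {β : Type*} [MeasurableSpace β] (g : (Fin n → α) → β)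
    (x : Fin n → α) (t : ℕ) : Measurable fun ω => g (state x ω t) := by
  let _ : MeasurableSpace (Fin n → α) := ⊤
  suffices h : Measurable fun ω => state x ω t from (measurable_from_top (f := g)).comp h
  induction t with
  | zero => exact measurable_const
  | succ t ih =>
    have h : Measurable fun q : Pair n × (Fin n → α) => sortPair q.1 q.2 :=
      measurable_from_prod_countable_right fun _ => measurable_from_top
    exact h.comp ((measurable_pi_apply t).prodMk ih)

/-- The induction removes the first step, not the last, which avoids conditional expectations; this
is why `x` is generalized. -/
theorem lintegral_state_le (p : PMF (Pair n)) (Φ : (Fin n → α) → ℝ≥0∞) {r : ℝ≥0∞}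
    (h : ∀ y, ∑ e, p e * Φ (sortPair e y) ≤ r * Φ y) (x : Fin n → α) (t : ℕ) :
    ∫⁻ ω, Φ (state x ω t) ∂(Measure.infinitePi fun _ : ℕ => p.toMeasure) ≤ r ^ t * Φ x := by
  induction t generalizing x with
  | zero => simp [state]
  | succ t ih =>
    rw [lintegral_infinitePi_cons p (measurable_comp_state Φ x (t + 1))]
    simp only [state_cons]
    calc _ ≤ ∑ e, p e * (r ^ t * Φ (sortPair e x)) :=
          Finset.sum_le_sum fun e _ => mul_le_mul_right (ih (sortPair e x)) (p e)
      _ = r ^ t * ∑ e, p e * Φ (sortPair e x) := by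
          rw [Finset.mul_sum]
          exact Finset.sum_congr rfl fun e _ => by ring
      _ ≤ r ^ t * (r * Φ x) := mul_le_mul_right (h x) _
      _ = r ^ (t + 1) * Φ x := by ring

theorem sortingTime_le_of_monotone {x : Fin n → α} {ω : ℕ → Pair n} {t : ℕ}
    (h : Monotone (state x ω t)) : sortingTime x ω ≤ t :=
  iInf₂_le t h

theorem exists_monotone_of_sortingTime_le {x : Fin n → α} {ω : ℕ → Pair n} {T : ℕ}
    (h : sortingTime x ω ≤ T) : ∃ t ≤ T, Monotone (state x ω t) := by
  by_contra! hc
  have h1 : ((T + 1 : ℕ) : ℕ∞) ≤ sortingTime x ω :=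
    le_iInf₂ fun t ht => by
      by_contra hlt
      have : t < T + 1 := by exact_mod_cast not_le.1 hlt
      exact hc t (by omega) ht
  have h2 : ((T + 1 : ℕ) : ℕ∞) ≤ (T : ℕ) := h1.trans h
  have h3 : T + 1 ≤ T := by exact_mod_cast h2
  omega

theorem measurable_sortingTime (x : Fin n → α) :
    Measurable fun ω => (sortingTime x ω : ℝ≥0∞) := by
  classical
  have h : (fun ω => (sortingTime x ω : ℝ≥0∞)) =
      fun ω => ⨅ t : ℕ, if Monotone (state x ω t) then (t : ℝ≥0∞) else ⊤ := by
    funext ω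
    refine le_antisymm (le_iInf fun t => ?_) ?_
    · split_ifs with ht
      · exact_mod_cast sortingTime_le_of_monotone ht
      · exact le_top
    · rcases eq_or_ne (sortingTime x ω) ⊤ with hτ | hτ
      · simp [hτ]
      · obtain ⟨m, hm⟩ := ENat.ne_top_iff_exists.1 hτ
        obtain ⟨t, htm, ht⟩ := exists_monotone_of_sortingTime_le hm.ge
        refine (iInf_le _ t).trans ?_
        rw [if_pos ht, ← hm]
        exact_mod_cast htm
  rw [h]
  exact Measurable.iInf fun t =>
    measurable_comp_state (fun y => if Monotone y then (t : ℝ≥0∞) else ⊤) x t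

-- Every time before the first sorted one counts 1 in the sum. That sorted lists stay sorted is not
-- needed.
open Classical in
theorem sortingTime_le_add_tsum (x : Fin n → α) (ω : ℕ → Pair n) (T : ℕ) :
    (sortingTime x ω : ℝ≥0∞) ≤
      T + ∑' t : ℕ, if Monotone (state x ω (T + t)) then 0 else 1 := by
  by_cases h : ∃ t, Monotone (state x ω (T + t))
  · have h1 : (sortingTime x ω : ℝ≥0∞) ≤ ((T + Nat.find h : ℕ) : ℕ∞) := by
      exact_mod_cast sortingTime_le_of_monotone (Nat.find_spec h)
    refine h1.trans ?_
    push_cast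
    gcongr
    refine le_trans ?_ (ENNReal.sum_le_tsum (Finset.range (Nat.find h)))
    rw [Finset.sum_congr rfl fun t ht =>
      if_neg (Nat.find_min h (Finset.mem_range.1 ht))]
    simp
  · push Not at h
    simp [h]

theorem sum_pair (f : Fin n → Fin n → ℝ) :
    ∑ e : Pair n, f e.1.1 e.1.2 = ∑ i, ∑ j, if i < j then f i j else 0 := by
  rw [← Fintype.sum_prod_type' (fun i j => if i < j then f i j else 0), ← Finset.sum_filter]
  exact (Finset.sum_subtype _ (by simp) fun q : Fin n × Fin n => f q.1 q.2).symm

/-- For 0/1 values the left side counts inversions. On the right only the first sum depends on the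
order of the values, so the effect of a swap can be read off from it. -/
theorem sum_pair_mul_one_sub (b : Fin n → ℝ) :
    ∑ e : Pair n, b e.1.1 * (1 - b e.1.2) =
      ∑ i, b i * (n - 1 - i) - ((∑ i, b i) ^ 2 - ∑ i, b i ^ 2) / 2 := by
  have h1 : ∑ e : Pair n, b e.1.1 = ∑ i, b i * (n - 1 - i) := by
    rw [sum_pair fun i _ => b i]
    refine Finset.sum_congr rfl fun i _ => ?_
    rw [← Finset.sum_filter, Finset.sum_const, nsmul_eq_mul, mul_comm]
    have : (Finset.univ.filter fun j => i < j) = Finset.Ioi i := by ext; simp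
    rw [this, Fin.card_Ioi]
    have := i.2
    rw [Nat.cast_sub (by omega), Nat.cast_sub (by omega), Nat.cast_one]
  have h2 : (∑ i, b i) ^ 2 - ∑ i, b i ^ 2 = 2 * ∑ e : Pair n, b e.1.1 * b e.1.2 := by
    rw [sum_pair fun i j => b i * b j, two_mul, sq, Finset.sum_mul_sum]
    nth_rewrite 3 [Finset.sum_comm]
    rw [← Finset.sum_add_distrib, ← Finset.sum_sub_distrib]
    refine Finset.sum_congr rfl fun i _ => ?_
    rw [← Finset.sum_add_distrib]
    have h3 : b i ^ 2 = ∑ j, if j = i then b i * b j else 0 := by simp [sq]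
    rw [h3, ← Finset.sum_sub_distrib]
    refine Finset.sum_congr rfl fun j _ => ?_
    rcases lt_trichotomy i j with h | h | h
    · simp [h, h.ne', h.not_gt]
    · simp [h]
    · simp [h, h.ne, h.not_gt, mul_comm]
  rw [h2, ← h1]
  simp only [mul_sub, mul_one, Finset.sum_sub_distrib]
  ring

/-- The number of inversions across the threshold `v`. -/
noncomputable def inversions (v : α) (x : Fin n → α) : ℝ :=
  ∑ e : Pair n, if v < x e.1.1 ∧ x e.1.2 ≤ v then 1 else 0

theorem inversions_nonneg (v : α) (x : Fin n → α) : 0 ≤ inversions v x :=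
  Finset.sum_nonneg fun _ _ => by split_ifs <;> norm_num

theorem inversions_eq (v : α) (x : Fin n → α) :
    inversions v x = ∑ i, (if v < x i then (1 : ℝ) else 0) * (n - 1 - i) -
      ((∑ i, if v < x i then (1 : ℝ) else 0) ^ 2 -
        ∑ i, (if v < x i then (1 : ℝ) else 0) ^ 2) / 2 := by
  rw [← sum_pair_mul_one_sub fun i => if v < x i then (1 : ℝ) else 0]
  refine Finset.sum_congr rfl fun e _ => ?_
  by_cases h1 : v < x e.1.1 <;> by_cases h2 : v < x e.1.2 <;>
    simp [h1, h2, not_le.2, not_lt.1]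

theorem inversions_le (v : α) (x : Fin n → α) : inversions v x ≤ (n : ℝ) ^ 2 := by
  have h1 : inversions v x ≤ ∑ _e : Pair n, (1 : ℝ) :=
    Finset.sum_le_sum fun _ _ => by split_ifs <;> norm_num
  refine h1.trans ?_
  rw [Finset.sum_const, nsmul_eq_mul, mul_one]
  have h2 : Fintype.card (Pair n) ≤ Fintype.card (Fin n × Fin n) := Fintype.card_subtype_le _
  rw [Fintype.card_prod, Fintype.card_fin, ← sq] at h2
  exact_mod_cast h2

theorem one_le_inversions {v : α} {x : Fin n → α} {i j : Fin n} (hij : i < j) (hi : v < x i)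
    (hj : x j ≤ v) : 1 ≤ inversions v x := by
  have h := Finset.single_le_sum (s := Finset.univ)
    (f := fun e : Pair n => if v < x e.1.1 ∧ x e.1.2 ≤ v then (1 : ℝ) else 0)
    (fun _ _ => by split_ifs <;> norm_num) (Finset.mem_univ ⟨(i, j), hij⟩)
  rwa [if_pos ⟨hi, hj⟩] at h

theorem inversions_sortPair (v : α) (e : Pair n) (x : Fin n → α) :
    inversions v (sortPair e x) = inversions v x -
      (if v < x e.1.1 ∧ x e.1.2 ≤ v then ((e.1.2 : ℕ) : ℝ) - (e.1.1 : ℕ) else 0) := by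
  rw [sortPair]
  split_ifs with hs hv hv
  · rw [inversions_eq, inversions_eq]
    set b : Fin n → ℝ := fun i => if v < x i then 1 else 0 with hb
    set σ := Equiv.swap e.1.1 e.1.2 with hσ
    change ∑ i, b (σ i) * (n - 1 - i) - ((∑ i, b (σ i)) ^ 2 - ∑ i, b (σ i) ^ 2) / 2 =
      ∑ i, b i * (n - 1 - i) - ((∑ i, b i) ^ 2 - ∑ i, b i ^ 2) / 2 - _
    rw [Equiv.sum_comp σ b, Equiv.sum_comp σ fun i => b i ^ 2]
    have h1 : ∑ i, b (σ i) * (n - 1 - i) - ∑ i, b i * (n - 1 - i) =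
        -(((e.1.2 : ℕ) : ℝ) - (e.1.1 : ℕ)) := by
      rw [← Finset.sum_sub_distrib, Fintype.sum_eq_add e.1.1 e.1.2 e.2.ne]
      · rw [hσ, Equiv.swap_apply_left, Equiv.swap_apply_right]
        simp only [hb, hv.1, hv.2.not_gt, if_true, if_false]
        ring
      · rintro i ⟨h1, h2⟩
        rw [hσ, Equiv.swap_apply_of_ne_of_ne h1 h2, sub_self]
    linarith
  -- A swap of two entries on the same side of `v` leaves the 0/1 list unchanged.
  · rw [inversions_eq, inversions_eq]
    have h0 : ∀ i, (v < (x ∘ Equiv.swap e.1.1 e.1.2) i) = (v < x i) := by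
      intro i
      have h2 : v < x e.1.1 ↔ v < x e.1.2 :=
        ⟨fun h => not_le.1 fun h' => hv ⟨h, h'⟩, fun h => h.trans hs⟩
      rcases eq_or_ne i e.1.1 with rfl | h3
      · simp [h2]
      rcases eq_or_ne i e.1.2 with rfl | h4
      · simp [h2]
      · simp [Equiv.swap_apply_of_ne_of_ne h3 h4]
    simp only [h0, sub_zero]
  · exact absurd (hv.2.trans_lt hv.1) hs
  · simp

end State

/-! ### Exponential decay of inversions under the harmonic weights. -/

section Harmonic

variable {n : ℕ} {α : Type*} [LinearOrder α]

/-- The sum of the harmonic weights of all pairs. -/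
noncomputable def totalWeight (n : ℕ) : ℝ := ∑ e : Pair n, (harmonicWeight n e : ℝ)

theorem coe_harmonicWeight (e : Pair n) :
    (harmonicWeight n e : ℝ) = (((e.1.2 : ℕ) - (e.1.1 : ℕ) : ℕ) : ℝ)⁻¹ := by
  rw [harmonicWeight, NNReal.coe_div, NNReal.coe_one, NNReal.coe_natCast, one_div]

/-- The reason for the harmonic weights: weight times decrease is the same for all inverted pairs.
-/
theorem harmonicWeight_mul_sub (e : Pair n) :
    (harmonicWeight n e : ℝ) * (((e.1.2 : ℕ) : ℝ) - (e.1.1 : ℕ)) = 1 := by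
  have h : (e.1.1 : ℕ) < e.1.2 := e.2
  rw [coe_harmonicWeight, Nat.cast_sub h.le]
  exact inv_mul_cancel₀ (sub_ne_zero.2 (by exact_mod_cast h.ne'))

theorem one_le_totalWeight (hn : 2 ≤ n) : 1 ≤ totalWeight n := by
  have h := Finset.single_le_sum (s := Finset.univ) (f := fun e : Pair n => (harmonicWeight n e : ℝ))
    (fun _ _ => NNReal.coe_nonneg _)
    (Finset.mem_univ ⟨(⟨0, by omega⟩, ⟨1, by omega⟩), by simp [Fin.lt_def]⟩)
  simpa [coe_harmonicWeight, totalWeight] using h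

theorem pairLaw_harmonicWeight_apply (hn : 2 ≤ n) (e : Pair n) :
    pairLaw (harmonicWeight n) (harmonicWeight_ne_zero hn) e =
      ENNReal.ofReal (harmonicWeight n e / totalWeight n) := by
  have hW := one_le_totalWeight hn
  rw [pairLaw, PMF.normalize_apply, tsum_fintype, div_eq_mul_inv,
    ENNReal.ofReal_mul (NNReal.coe_nonneg _), ENNReal.ofReal_coe_nnreal,
    ENNReal.ofReal_inv_of_pos (by linarith), totalWeight,
    ENNReal.ofReal_sum_of_nonneg fun _ _ => NNReal.coe_nonneg _]
  simp

theorem sum_harmonicWeight_mul_inversions (v : α) (y : Fin n → α) :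
    ∑ e : Pair n, (harmonicWeight n e : ℝ) * inversions v (sortPair e y) =
      (totalWeight n - 1) * inversions v y := by
  have h : ∀ e : Pair n, (harmonicWeight n e : ℝ) * inversions v (sortPair e y) =
      harmonicWeight n e * inversions v y - if v < y e.1.1 ∧ y e.1.2 ≤ v then 1 else 0 := by
    intro e
    rw [inversions_sortPair, mul_sub, mul_ite, mul_zero, harmonicWeight_mul_sub]
  rw [Finset.sum_congr rfl fun e _ => h e, Finset.sum_sub_distrib, ← Finset.sum_mul, sub_mul,
    one_mul]
  rfl

theorem lintegral_inversions_le (hn : 2 ≤ n) (v : α) (x : Fin n → α) (t : ℕ) :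
    ∫⁻ ω, ENNReal.ofReal (inversions v (state x ω t)) ∂(harmonicLaw n hn) ≤
      ENNReal.ofReal ((1 - (totalWeight n)⁻¹) ^ t * (n : ℝ) ^ 2) := by
  have hW := one_le_totalWeight hn
  have hr : 0 ≤ 1 - (totalWeight n)⁻¹ := sub_nonneg.2 (inv_le_one_of_one_le₀ hW)
  refine (lintegral_state_le (pairLaw (harmonicWeight n) (harmonicWeight_ne_zero hn))
    (fun y => ENNReal.ofReal (inversions v y)) (r := ENNReal.ofReal (1 - (totalWeight n)⁻¹))
    (fun y => le_of_eq ?_) x t).trans ?_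
  · rw [Finset.sum_congr rfl fun e _ => by rw [pairLaw_harmonicWeight_apply hn e],
      ← ENNReal.ofReal_mul hr]
    have h1 : ∀ e : Pair n, ENNReal.ofReal (harmonicWeight n e / totalWeight n) *
        ENNReal.ofReal (inversions v (sortPair e y)) =
        ENNReal.ofReal ((totalWeight n)⁻¹ *
          (harmonicWeight n e * inversions v (sortPair e y))) := fun e => by
      rw [← ENNReal.ofReal_mul (by positivity)]
      congr 1
      ring
    rw [Finset.sum_congr rfl fun e _ => h1 e, ← ENNReal.ofReal_sum_of_nonneg fun e _ =>
      mul_nonneg (by positivity) (mul_nonneg (NNReal.coe_nonneg _) (inversions_nonneg _ _)),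
      ← Finset.mul_sum, sum_harmonicWeight_mul_inversions]
    congr 1
    field_simp
  · rw [← ENNReal.ofReal_pow hr, ← ENNReal.ofReal_mul (by positivity)]
    exact ENNReal.ofReal_le_ofReal
      (mul_le_mul_of_nonneg_left (inversions_le v x) (by positivity))

theorem measure_not_monotone_le (hn : 2 ≤ n) (x : Fin n → α) (t : ℕ) :
    harmonicLaw n hn {ω | ¬ Monotone (state x ω t)} ≤
      ENNReal.ofReal ((n : ℝ) ^ 3 * (1 - (totalWeight n)⁻¹) ^ t) := by
  have hW := one_le_totalWeight hn
  have hr : 0 ≤ 1 - (totalWeight n)⁻¹ := sub_nonneg.2 (inv_le_one_of_one_le₀ hW)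
  have hmeas : MeasurableSet {ω | ¬ Monotone (state x ω t)} :=
    measurable_comp_state (β := Prop) (fun y => ¬ Monotone y) x t (measurableSet_singleton True)
      |>.congr (by ext; simp)
  rw [← lintegral_indicator_one hmeas]
  calc _ ≤ ∫⁻ ω, ∑ k, ENNReal.ofReal (inversions (x k) (state x ω t)) ∂(harmonicLaw n hn) := by
        refine lintegral_mono fun ω => ?_
        by_cases hω : ω ∈ {ω | ¬ Monotone (state x ω t)}
        swap
        · rw [Set.indicator_of_notMem hω]
          exact zero_le
        rw [Set.indicator_of_mem hω]
        obtain ⟨i, j, hij, hlt⟩ : ∃ i j, i ≤ j ∧ state x ω t j < state x ω t i := by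
          simpa [Monotone] using hω
        have hij' : i < j := lt_of_le_of_ne hij fun h => by simp [h] at hlt
        -- The smaller entry of an inverted pair serves as threshold. It is an entry of the initial
        -- list, so `n` fixed thresholds suffice.
        obtain ⟨k, hk⟩ := exists_state_eq x ω t j
        refine le_trans ?_ (Finset.single_le_sum (fun _ _ => zero_le) (Finset.mem_univ k))
        rw [Pi.one_apply, ← ENNReal.ofReal_one]
        exact ENNReal.ofReal_le_ofReal (one_le_inversions hij' (hk ▸ hlt) hk.le)
    _ = ∑ k, ∫⁻ ω, ENNReal.ofReal (inversions (x k) (state x ω t)) ∂(harmonicLaw n hn) :=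
        lintegral_finsetSum _ fun k _ =>
          measurable_comp_state (fun y => ENNReal.ofReal (inversions (x k) y)) x t
    _ ≤ ∑ _k : Fin n, ENNReal.ofReal ((1 - (totalWeight n)⁻¹) ^ t * (n : ℝ) ^ 2) :=
        Finset.sum_le_sum fun k _ => lintegral_inversions_le hn (x k) x t
    _ = _ := by
        rw [Finset.sum_const, Finset.card_univ, Fintype.card_fin, nsmul_eq_mul,
          ← ENNReal.ofReal_natCast, ← ENNReal.ofReal_mul (by positivity)]
        congr 1
        ring

theorem one_sub_inv_pow_le_exp {W : ℝ} (hW : 1 ≤ W) (t : ℕ) :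
    (1 - W⁻¹) ^ t ≤ Real.exp (-(t / W)) := by
  have h1 : 1 - W⁻¹ ≤ Real.exp (-W⁻¹) := by linarith [Real.add_one_le_exp (-W⁻¹)]
  refine (pow_le_pow_left₀ (sub_nonneg.2 (inv_le_one_of_one_le₀ hW)) h1 t).trans (le_of_eq ?_)
  rw [← Real.exp_nat_mul]
  congr 1
  ring

/-- Tail summation beyond time `T`: the geometric series of ratio `1 - 1 / W` sums to `W`. -/
theorem lintegral_sortingTime_le (hn : 2 ≤ n) (x : Fin n → α) (T : ℕ) :
    ∫⁻ ω, (sortingTime x ω : ℝ≥0∞) ∂(harmonicLaw n hn) ≤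
      ENNReal.ofReal (T + (n : ℝ) ^ 3 * (1 - (totalWeight n)⁻¹) ^ T * totalWeight n) := by
  classical
  have hW := one_le_totalWeight hn
  have hr : 0 ≤ 1 - (totalWeight n)⁻¹ := sub_nonneg.2 (inv_le_one_of_one_le₀ hW)
  have : IsProbabilityMeasure (harmonicLaw n hn) := by
    unfold harmonicLaw sorterLaw; infer_instance
  have hm : ∀ t, Measurable fun ω => if Monotone (state x ω t) then (0 : ℝ≥0∞) else 1 :=
    fun t => measurable_comp_state (fun y => if Monotone y then (0 : ℝ≥0∞) else 1) x t
  have hmeas : ∀ t, MeasurableSet {ω | ¬ Monotone (state x ω t)} := fun t =>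
    measurable_comp_state (β := Prop) (fun y => ¬ Monotone y) x t (measurableSet_singleton True)
      |>.congr (by ext; simp)
  calc _ ≤ ∫⁻ ω, (T + ∑' t : ℕ, if Monotone (state x ω (T + t)) then (0 : ℝ≥0∞) else 1)
          ∂(harmonicLaw n hn) := lintegral_mono fun ω => sortingTime_le_add_tsum x ω T
    _ = T + ∑' t : ℕ, harmonicLaw n hn {ω | ¬ Monotone (state x ω (T + t))} := by
        rw [lintegral_add_left measurable_const, lintegral_const, measure_univ, mul_one,
          lintegral_tsum fun t => (hm (T + t)).aemeasurable]
        congr 2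
        funext t
        rw [← lintegral_indicator_one (hmeas (T + t))]
        congr 1
        funext ω
        by_cases h : Monotone (state x ω (T + t)) <;> simp [h]
    _ ≤ T + ∑' t : ℕ, ENNReal.ofReal ((n : ℝ) ^ 3 * (1 - (totalWeight n)⁻¹) ^ T *
          (1 - (totalWeight n)⁻¹) ^ t) := by
        gcongr with t
        refine (measure_not_monotone_le hn x (T + t)).trans (le_of_eq ?_)
        rw [pow_add, mul_assoc]
    _ = _ := by
        have hlt : 1 - (totalWeight n)⁻¹ < 1 := by
          have : 0 < (totalWeight n)⁻¹ := by positivity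
          linarith
        rw [← ENNReal.ofReal_tsum_of_nonneg (fun t => by positivity)
          ((summable_geometric_of_lt_one hr hlt).mul_left _), tsum_mul_left,
          tsum_geometric_of_lt_one hr hlt, ENNReal.ofReal_add (by positivity) (by positivity),
          ENNReal.ofReal_natCast, sub_sub_cancel, inv_inv]

end Harmonic


/-! ### The total weight has order `n log n`. -/

section TotalWeight

/-- Terms with `j ≤ i` vanish, by truncated subtraction and `0⁻¹ = 0`. -/
theorem sum_range_inv_sub (i n : ℕ) :
    ∑ j ∈ Finset.range n, (((j - i : ℕ) : ℝ))⁻¹ = harmonic (n - 1 - i) := by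
  induction n with
  | zero => simp
  | succ n ih =>
    rw [Finset.sum_range_succ, ih]
    by_cases h : i < n
    · have h1 : n + 1 - 1 - i = (n - 1 - i) + 1 := by omega
      have h2 : n - i = n - 1 - i + 1 := by omega
      rw [h1, harmonic_succ, h2]
      push_cast
      ring
    · have h1 : n + 1 - 1 - i = 0 := by omega
      have h2 : n - 1 - i = 0 := by omega
      have h3 : n - i = 0 := by omega
      simp [h2, h3]

theorem totalWeight_eq (n : ℕ) :
    totalWeight n = ∑ m ∈ Finset.range n, (harmonic m : ℝ) := by
  rw [totalWeight, Finset.sum_congr rfl fun e _ => coe_harmonicWeight e,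
    sum_pair fun i j => (((j : ℕ) - (i : ℕ) : ℕ) : ℝ)⁻¹]
  rw [← Finset.sum_range_reflect, ← Fin.sum_univ_eq_sum_range (fun m => (harmonic (n - 1 - m) : ℝ))]
  refine Finset.sum_congr rfl fun i _ => ?_
  rw [← sum_range_inv_sub, ← Fin.sum_univ_eq_sum_range (fun j => (((j - i : ℕ) : ℝ))⁻¹)]
  refine Finset.sum_congr rfl fun j _ => ?_
  split_ifs with h
  · rfl
  · have h' : (j : ℕ) - (i : ℕ) = 0 := Nat.sub_eq_zero_of_le (not_lt.1 h)
    simp [h']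

theorem totalWeight_le (n : ℕ) : totalWeight n ≤ n * (1 + Real.log n) := by
  rw [totalWeight_eq]
  refine (Finset.sum_le_card_nsmul _ _ (1 + Real.log n) fun m hm => ?_).trans
    (by rw [Finset.card_range, nsmul_eq_mul])
  refine (harmonic_le_one_add_log m).trans ?_
  rcases Nat.eq_zero_or_pos m with rfl | h
  · simpa using Real.log_natCast_nonneg n
  · gcongr
    exact (Finset.mem_range.1 hm).le

/-- Summing `log (m + 1) ≤ harmonic m` gives `log n!`, which is bounded below through `n ^ n / n! ≤
exp n`. -/
theorem le_totalWeight {n : ℕ} (hn : 1 ≤ n) : n * Real.log n - n ≤ totalWeight n := by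
  have h1 : Real.log (n.factorial) ≤ totalWeight n := by
    rw [totalWeight_eq, ← Finset.prod_range_add_one_eq_factorial, Nat.cast_prod,
      Real.log_prod fun m _ => by positivity]
    exact Finset.sum_le_sum fun m _ => log_add_one_le_harmonic m
  have hn' : (0 : ℝ) < n := by exact_mod_cast hn
  have hf : (0 : ℝ) < n.factorial := by exact_mod_cast n.factorial_pos
  have h2 := Real.log_le_log (by positivity) (Real.pow_div_factorial_le_exp (n : ℝ) hn'.le n)
  rw [Real.log_exp, Real.log_div (by positivity) hf.ne', Real.log_pow] at h2
  linarith

end TotalWeight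

/-! ### The hard permutation and its reduction to coupon collecting. -/

section PairFlip

/-- The involution of `[n]` exchanging `2 k` and `2 k + 1`. -/
def pairFlip {n : ℕ} (i : Fin n) : Fin n :=
  if h : (i : ℕ) % 2 = 0 then if h' : (i : ℕ) + 1 < n then ⟨i + 1, h'⟩ else i
  else ⟨i - 1, by omega⟩

theorem pairFlip_involutive (n : ℕ) : Function.Involutive (pairFlip (n := n)) := by
  intro i
  ext
  have := i.2
  simp only [pairFlip]
  split_ifs <;> simp_all <;> omega

/-- The permutation of `[n]` exchanging `2 k` and `2 k + 1`. -/
def pairFlipPerm (n : ℕ) : Equiv.Perm (Fin n) := (pairFlip_involutive n).toPerm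

/-- The pairs `{2 k, 2 k + 1}`. -/
def blockPairs (n : ℕ) : Finset (Pair n) :=
  Finset.univ.filter fun e => (e.1.1 : ℕ) % 2 = 0 ∧ (e.1.2 : ℕ) = e.1.1 + 1

theorem mem_blockPairs {n : ℕ} {e : Pair n} :
    e ∈ blockPairs n ↔ (e.1.1 : ℕ) % 2 = 0 ∧ (e.1.2 : ℕ) = e.1.1 + 1 := by
  simp [blockPairs]

theorem le_card_blockPairs (n : ℕ) : n / 2 ≤ (blockPairs n).card := by
  have h := Finset.card_le_card_of_injOn (s := (Finset.univ : Finset (Fin (n / 2))))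
    (t := blockPairs n)
    (fun k => ⟨(⟨2 * k, by omega⟩, ⟨2 * k + 1, by omega⟩), by simp [Fin.lt_def]⟩)
    (fun k _ => by simp [mem_blockPairs])
    (fun k _ l _ h => by
      simp only [Subtype.mk.injEq, Prod.mk.injEq, Fin.mk.injEq] at h
      exact Fin.ext (by omega))
  simpa using h

theorem pairFlip_div_two {n : ℕ} (i : Fin n) : (pairFlip i : ℕ) / 2 = (i : ℕ) / 2 := by
  simp only [pairFlip]
  split_ifs <;> simp <;> omega

/-- Entries in different blocks are already in the right order, so no swap moves an entry out of its
block. -/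
theorem state_div_two {n : ℕ} {x : Fin n → Fin n} (hx : ∀ i, (x i : ℕ) / 2 = (i : ℕ) / 2)
    (ω : ℕ → Pair n) (t : ℕ) (i : Fin n) : ((state x ω t i : Fin n) : ℕ) / 2 = (i : ℕ) / 2 := by
  induction t generalizing i with
  | zero => exact hx i
  | succ t ih =>
    rw [state, sortPair]
    split_ifs with h
    · have h1 := ih (ω t).1.1
      have h2 := ih (ω t).1.2
      have h3 : ((ω t).1.1 : ℕ) < (ω t).1.2 := (ω t).2
      have h4 : ((state x ω t (ω t).1.2 : Fin n) : ℕ) < (state x ω t (ω t).1.1 : Fin n) := h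
      rw [Function.comp_apply, ih]
      rcases eq_or_ne i (ω t).1.1 with rfl | h5
      · rw [Equiv.swap_apply_left]; omega
      rcases eq_or_ne i (ω t).1.2 with rfl | h6
      · rw [Equiv.swap_apply_right]; omega
      · rw [Equiv.swap_apply_of_ne_of_ne h5 h6]
    · exact ih i

theorem state_lt_of_forall_ne {n : ℕ} {x : Fin n → Fin n}
    (hx : ∀ i, (x i : ℕ) / 2 = (i : ℕ) / 2) {e : Pair n} (he : e ∈ blockPairs n)
    (hxe : x e.1.2 < x e.1.1) (ω : ℕ → Pair n) (t : ℕ) (h : ∀ s < t, ω s ≠ e) :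
    state x ω t e.1.2 < state x ω t e.1.1 := by
  induction t with
  | zero => exact hxe
  | succ t ih =>
    have ih' := ih fun s hs => h s (by omega)
    rw [state, sortPair]
    split_ifs with hs
    · have h1 := state_div_two hx ω t (ω t).1.1
      have h2 := state_div_two hx ω t (ω t).1.2
      have h3 : ((ω t).1.1 : ℕ) < (ω t).1.2 := (ω t).2
      have h4 : ((state x ω t (ω t).1.2 : Fin n) : ℕ) < (state x ω t (ω t).1.1 : Fin n) := hs
      obtain ⟨h5, h6⟩ := mem_blockPairs.1 he
      -- An actual swap takes place inside one block; as `ω t ≠ e`, that block is disjoint from `e`.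
      have hne : ((ω t).1.1 : ℕ) ≠ e.1.1 := fun h7 => h t (by omega)
        (Subtype.ext (Prod.ext (Fin.ext h7) (Fin.ext (by omega))))
      have n1 : e.1.1 ≠ (ω t).1.1 := fun h => by rw [h] at hne; exact hne rfl
      have n2 : e.1.1 ≠ (ω t).1.2 := fun h => by have := congrArg Fin.val h; omega
      have n3 : e.1.2 ≠ (ω t).1.1 := fun h => by have := congrArg Fin.val h; omega
      have n4 : e.1.2 ≠ (ω t).1.2 := fun h => by have := congrArg Fin.val h; omega
      rw [Function.comp_apply, Function.comp_apply, Equiv.swap_apply_of_ne_of_ne n1 n2,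
        Equiv.swap_apply_of_ne_of_ne n3 n4]
      exact ih'
    · exact ih'

theorem pairFlip_lt {n : ℕ} {e : Pair n} (he : e ∈ blockPairs n) :
    pairFlip e.1.2 < pairFlip e.1.1 := by
  obtain ⟨h5, h6⟩ := mem_blockPairs.1 he
  have h7 := e.1.2.2
  rw [Fin.lt_def]
  simp only [pairFlip]
  rw [dif_neg (by omega), dif_pos h5, dif_pos (by omega)]
  simp only
  omega

theorem measure_sortingTime_pairFlipPerm_le {n : ℕ} (hn : 2 ≤ n) (T : ℕ) :
    harmonicLaw n hn {ω | sortingTime (pairFlipPerm n) ω ≤ T} ≤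
      ENNReal.ofReal ((1 - (1 - (totalWeight n)⁻¹) ^ T) ^ (n / 2)) := by
  have hW := one_le_totalWeight hn
  have hW' : (totalWeight n)⁻¹ ≤ 1 := inv_le_one_of_one_le₀ hW
  have hr : 0 ≤ 1 - (totalWeight n)⁻¹ := sub_nonneg.2 hW'
  have hq : 0 ≤ (totalWeight n)⁻¹ := by positivity
  refine (measure_mono fun ω hω => ?_).trans
    ((infinitePi_collect_le (pairLaw (harmonicWeight n) (harmonicWeight_ne_zero hn))
      (q := (totalWeight n)⁻¹) hq T (blockPairs n) fun e he => ?_).trans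
      (ENNReal.ofReal_le_ofReal (pow_le_pow_of_le_one
        (sub_nonneg.2 (pow_le_one₀ hr (by linarith)))
        (by linarith [pow_nonneg hr T]) (le_card_blockPairs n))))
  · obtain ⟨t, ht, hmono⟩ := exists_monotone_of_sortingTime_le hω
    intro e he
    by_contra! hc
    exact (state_lt_of_forall_ne (x := pairFlipPerm n) pairFlip_div_two he (pairFlip_lt he) ω t
      fun s hs => hc s (by omega)).not_ge (hmono e.2.le)
  · rw [pairLaw_harmonicWeight_apply hn, coe_harmonicWeight, (mem_blockPairs.1 he).2,
      Nat.add_sub_cancel_left, Nat.cast_one, inv_one, one_div]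

theorem one_le_sortingTime_pairFlipPerm {n : ℕ} (hn : 2 ≤ n) (ω : ℕ → Pair n) :
    1 ≤ sortingTime (pairFlipPerm n) ω := by
  refine le_iInf₂ fun t ht => ?_
  rcases Nat.eq_zero_or_pos t with rfl | h
  · let e : Pair n := ⟨(⟨0, by omega⟩, ⟨1, by omega⟩), by simp [Fin.lt_def]⟩
    have he : e ∈ blockPairs n := mem_blockPairs.2 (by simp [e])
    exact absurd (ht e.2.le) (pairFlip_lt he).not_ge
  · exact_mod_cast h

end PairFlip

/-! ### Numerical estimates for the lower bound. -/

section Asymptotics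

theorem exp_neg_two_mul_le_one_sub {q : ℝ} (h0 : 0 ≤ q) (h1 : q ≤ 1 / 2) :
    Real.exp (-(2 * q)) ≤ 1 - q := by
  rw [Real.exp_neg]
  refine (inv_anti₀ (by positivity) (Real.add_one_le_exp (2 * q))).trans ?_
  rw [inv_le_iff_one_le_mul₀ (by positivity)]
  nlinarith

/-- For `n ≥ 8`, `log n ≥ 2` and hence `W ≥ n log n / 2`. So `T / W ≤ log n / 4`, and a given pair
is missed with probability at least `exp (-2 T / W) ≥ n ^ (-1/2)`. All `⌊n / 2⌋ ≥ n / 3` pairs are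
hit with probability at most `(1 - n ^ (-1/2)) ^ (n / 3)`. -/
theorem measure_sortingTime_pairFlipPerm_le_exp {n : ℕ} (hn : 8 ≤ n) :
    harmonicLaw n (by omega) {ω | (sortingTime (pairFlipPerm n) ω : ℝ≥0∞) ≤
      ENNReal.ofReal (1 / 8 * (n * Real.log n ^ 2))} ≤
      ENNReal.ofReal (Real.exp (-((n : ℝ) ^ (1 / 2 : ℝ) / 3))) := by
  set T := ⌊1 / 8 * (n * Real.log n ^ 2)⌋₊ with hT
  have hn8 : (8 : ℝ) ≤ n := by exact_mod_cast hn
  have hlog : 2 ≤ Real.log n := by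
    have h1 : Real.log 8 ≤ Real.log n := Real.log_le_log (by norm_num) hn8
    have h2 : Real.log 8 = 3 * Real.log 2 := by
      rw [show (8 : ℝ) = 2 ^ 3 by norm_num, Real.log_pow]; norm_num
    linarith [Real.log_two_gt_d9]
  have hW : n * Real.log n / 2 ≤ totalWeight n := by
    have := le_totalWeight (show 1 ≤ n by omega)
    nlinarith
  have hWpos : 0 < n * Real.log n / 2 := by positivity
  have hW2 : 2 ≤ totalWeight n := by nlinarith
  have hq : (totalWeight n)⁻¹ ≤ 1 / 2 := by
    rw [one_div]
    exact inv_anti₀ (by norm_num) hW2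
  have hq0 : 0 ≤ (totalWeight n)⁻¹ := by positivity
  have hTle : (T : ℝ) ≤ 1 / 8 * (n * Real.log n ^ 2) := Nat.floor_le (by positivity)
  refine (measure_mono fun ω hω => ?_).trans
    ((measure_sortingTime_pairFlipPerm_le (by omega) T).trans (ENNReal.ofReal_le_ofReal ?_))
  · rw [Set.mem_ofPred_eq] at hω ⊢
    have hne : sortingTime (pairFlipPerm n) ω ≠ ⊤ := fun h => by
      rw [h, ENat.toENNReal_top, top_le_iff] at hω
      exact ENNReal.ofReal_ne_top hω
    obtain ⟨m, hm⟩ := ENat.ne_top_iff_exists.1 hne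
    rw [← hm] at hω ⊢
    rw [ENat.toENNReal_coe, ← ENNReal.ofReal_natCast,
      ENNReal.ofReal_le_ofReal_iff (by positivity)] at hω
    exact_mod_cast Nat.le_floor hω
  · have h1 : Real.exp (-(Real.log n / 2)) ≤ (1 - (totalWeight n)⁻¹) ^ T := by
      refine le_trans ?_ (pow_le_pow_left₀ (Real.exp_nonneg _)
        (exp_neg_two_mul_le_one_sub hq0 hq) T)
      rw [← Real.exp_nat_mul, Real.exp_le_exp]
      have h2 : T * (totalWeight n)⁻¹ ≤ Real.log n / 4 := by
        rw [← div_eq_mul_inv, div_le_iff₀ (by linarith)]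
        calc (T : ℝ) ≤ Real.log n / 4 * (n * Real.log n / 2) := by linarith
          _ ≤ _ := mul_le_mul_of_nonneg_left hW (by linarith)
      linarith
    have h3 : 0 ≤ 1 - (1 - (totalWeight n)⁻¹) ^ T :=
      sub_nonneg.2 (pow_le_one₀ (by linarith) (by linarith))
    have h4 : 1 - (1 - (totalWeight n)⁻¹) ^ T ≤ Real.exp (-Real.exp (-(Real.log n / 2))) := by
      linarith [Real.add_one_le_exp (-Real.exp (-(Real.log n / 2)))]
    refine (pow_le_pow_left₀ h3 h4 _).trans ?_
    rw [← Real.exp_nat_mul, Real.exp_le_exp]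
    have h5 : (n : ℝ) / 3 ≤ ((n / 2 : ℕ) : ℝ) := by
      have h6 : n ≤ 3 * (n / 2) := by omega
      have h7 : (n : ℝ) ≤ 3 * ((n / 2 : ℕ) : ℝ) := by exact_mod_cast h6
      linarith
    have h8 : (n : ℝ) ^ (1 / 2 : ℝ) = n * Real.exp (-(Real.log n / 2)) := by
      have hn0 : (0 : ℝ) < n := by linarith
      rw [Real.rpow_def_of_pos hn0]
      nth_rewrite 2 [← Real.exp_log hn0]
      rw [← Real.exp_add]
      congr 1
      ring
    rw [h8]
    have := mul_le_mul_of_nonneg_right h5 (Real.exp_nonneg (-(Real.log n / 2)))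
    linarith

theorem eventually_exp_neg_sqrt_le (A : ℝ) :
    ∀ᶠ n : ℕ in atTop, Real.exp (-((n : ℝ) ^ (1 / 2 : ℝ) / 3)) ≤ (n : ℝ) ^ (-A) := by
  have h := (isLittleO_log_rpow_atTop (r := 1 / 2) (by norm_num)).comp_tendsto
    (tendsto_natCast_atTop_atTop (R := ℝ))
  have h1 := h.def (c := 1 / (3 * (|A| + 1))) (by positivity)
  filter_upwards [h1, eventually_ge_atTop 1] with n hn hn1
  have hn0 : (0 : ℝ) < n := by exact_mod_cast hn1
  rw [Real.rpow_def_of_pos hn0 (-A), Real.exp_le_exp]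
  simp only [Function.comp_apply, Real.norm_eq_abs] at hn
  rw [abs_of_nonneg (Real.log_natCast_nonneg n),
    abs_of_nonneg (Real.rpow_nonneg hn0.le _), div_mul_eq_mul_div,
    le_div_iff₀ (by positivity)] at hn
  have hl := Real.log_natCast_nonneg n
  have h2 : A * Real.log n ≤ |A| * Real.log n := mul_le_mul_of_nonneg_right (le_abs_self A) hl
  linarith

theorem one_le_three_halves_mul_log {n : ℕ} (hn : 2 ≤ n) : 1 ≤ 3 / 2 * Real.log n := by
  have h1 : Real.log 2 ≤ Real.log n := Real.log_le_log (by norm_num) (by exact_mod_cast hn)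
  linarith [Real.log_two_gt_d9]

theorem totalWeight_le_mul_log {n : ℕ} (hn : 2 ≤ n) :
    totalWeight n ≤ 5 / 2 * (n * Real.log n) := by
  refine (totalWeight_le n).trans ?_
  have := mul_le_mul_of_nonneg_left (one_le_three_halves_mul_log hn) (Nat.cast_nonneg (α := ℝ) n)
  linarith

end Asymptotics

/-! ### The bounds in final form. -/

section Bounds

variable {n : ℕ} {α : Type*} [LinearOrder α]

theorem lintegral_sortingTime_le_log (hn : 2 ≤ n) (x : Fin n → α) :
    ∫⁻ ω, (sortingTime x ω : ℝ≥0∞) ∂(harmonicLaw n hn) ≤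
      ENNReal.ofReal (15 * (n * Real.log n ^ 2)) := by
  have hW := one_le_totalWeight hn
  have hW' := totalWeight_le_mul_log hn
  have hl := one_le_three_halves_mul_log hn
  have hn2 : (2 : ℝ) ≤ n := by exact_mod_cast hn
  have hl0 : 0 ≤ Real.log n := by linarith
  -- At this time the factor `n ^ 3` has been absorbed, so the remaining expected time is at most
  -- `W`.
  refine (lintegral_sortingTime_le hn x ⌈3 * totalWeight n * Real.log n⌉₊).trans
    (ENNReal.ofReal_le_ofReal ?_)
  set T := ⌈3 * totalWeight n * Real.log n⌉₊ with hT
  have hT1 : (T : ℝ) ≤ 3 * totalWeight n * Real.log n + 1 :=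
    (Nat.ceil_lt_add_one (by positivity)).le
  have hT2 : 3 * totalWeight n * Real.log n ≤ T := Nat.le_ceil _
  have h1 : (n : ℝ) ^ 3 * (1 - (totalWeight n)⁻¹) ^ T ≤ 1 := by
    have h2 : (n : ℝ) ^ 3 = Real.exp (3 * Real.log n) := by
      rw [mul_comm, Real.exp_mul, Real.exp_log (by linarith)]
      norm_cast
    rw [h2]
    refine (mul_le_mul_of_nonneg_left (one_sub_inv_pow_le_exp hW T)
      (Real.exp_nonneg _)).trans ?_
    rw [← Real.exp_add, Real.exp_le_one_iff]
    have : 3 * Real.log n ≤ T / totalWeight n := by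
      rw [le_div_iff₀ (by linarith)]; linarith
    linarith
  have h3 := mul_le_mul_of_nonneg_right h1 (by linarith : 0 ≤ totalWeight n)
  have h4 : totalWeight n * Real.log n ≤ 5 / 2 * (n * Real.log n ^ 2) := by
    nlinarith [mul_le_mul_of_nonneg_right hW' hl0]
  have h5 : n * Real.log n ≤ 3 / 2 * (n * Real.log n ^ 2) := by
    nlinarith [mul_le_mul_of_nonneg_right hl (by positivity : 0 ≤ n * Real.log n)]
  have h6 : 1 ≤ 9 / 8 * (n * Real.log n ^ 2) := by
    nlinarith [mul_nonneg hl0 (by linarith : (0 : ℝ) ≤ n - 2)]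
  linarith

theorem measure_sortingTime_gt_le (hn : 2 ≤ n) (x : Fin n → α) {A : ℝ} (hA : 0 < A) :
    harmonicLaw n hn {ω | ENNReal.ofReal (5 / 2 * (A + 5) * (n * Real.log n ^ 2)) <
      (sortingTime x ω : ℝ≥0∞)} ≤ ENNReal.ofReal ((n : ℝ) ^ (-A)) := by
  have hW := one_le_totalWeight hn
  have hW' := totalWeight_le_mul_log hn
  have hl := one_le_three_halves_mul_log hn
  have hn2 : (2 : ℝ) ≤ n := by exact_mod_cast hn
  have hl0 : 0 ≤ Real.log n := by linarith
  set B := 5 / 2 * (A + 5) * (n * Real.log n ^ 2) with hB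
  have hB0 : 0 ≤ B := by positivity
  refine (measure_mono fun ω hω => ?_).trans
    ((measure_not_monotone_le hn x ⌊B⌋₊).trans (ENNReal.ofReal_le_ofReal ?_))
  · rw [Set.mem_ofPred_eq] at hω ⊢
    intro hm
    have h1 : (sortingTime x ω : ℝ≥0∞) ≤ ((⌊B⌋₊ : ℕ) : ℕ∞) := by
      exact_mod_cast sortingTime_le_of_monotone hm
    refine (h1.trans ?_).not_gt hω
    rw [ENat.toENNReal_coe, ← ENNReal.ofReal_natCast]
    exact ENNReal.ofReal_le_ofReal (Nat.floor_le hB0)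
  · have h2 : (n : ℝ) ^ 3 = Real.exp (3 * Real.log n) := by
      rw [mul_comm, Real.exp_mul, Real.exp_log (by linarith)]
      norm_cast
    rw [h2, Real.rpow_def_of_pos (by linarith)]
    refine (mul_le_mul_of_nonneg_left (one_sub_inv_pow_le_exp hW _)
      (Real.exp_nonneg _)).trans ?_
    rw [← Real.exp_add, Real.exp_le_exp]
    -- Of the 5 in `A + 5`, 3 pays for the factor `n ^ 3` and 2 for rounding down `B`.
    have h3 : (A + 3) * Real.log n ≤ ⌊B⌋₊ / totalWeight n := by
      rw [le_div_iff₀ (by linarith)]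
      have h4 : B < ⌊B⌋₊ + 1 := Nat.lt_floor_add_one B
      have h5 : (A + 5) * Real.log n * totalWeight n ≤ B := by
        rw [hB]
        nlinarith [mul_le_mul_of_nonneg_left hW' (by positivity : 0 ≤ (A + 5) * Real.log n)]
      have h6 : 1 ≤ 2 * Real.log n * totalWeight n := by nlinarith
      linarith
    linarith

theorem exists_lower_bound : ∃ c : ℝ, 0 < c ∧
    (∀ (n : ℕ) (hn : 2 ≤ n), ENNReal.ofReal (c * (n * Real.log n ^ 2)) ≤
      ∫⁻ ω, (sortingTime (pairFlipPerm n) ω : ℝ≥0∞) ∂(harmonicLaw n hn)) ∧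
    (∀ A : ℝ, 0 < A → ∃ n₀ : ℕ, ∀ (n : ℕ) (hn : 2 ≤ n), n₀ ≤ n →
      harmonicLaw n hn {ω | (sortingTime (pairFlipPerm n) ω : ℝ≥0∞) ≤
        ENNReal.ofReal (c * (n * Real.log n ^ 2))} ≤ ENNReal.ofReal ((n : ℝ) ^ (-A))) := by
  have htail : ∀ A : ℝ, ∃ n₀ : ℕ, ∀ (n : ℕ) (hn : 2 ≤ n), n₀ ≤ n →
      harmonicLaw n hn {ω | (sortingTime (pairFlipPerm n) ω : ℝ≥0∞) ≤
        ENNReal.ofReal (1 / 8 * (n * Real.log n ^ 2))} ≤ ENNReal.ofReal ((n : ℝ) ^ (-A)) := by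
    intro A
    obtain ⟨N, hN⟩ := eventually_atTop.1 (eventually_exp_neg_sqrt_le A)
    exact ⟨max N 8, fun n hn hNn =>
      (measure_sortingTime_pairFlipPerm_le_exp (le_of_max_le_right hNn)).trans
        (ENNReal.ofReal_le_ofReal (hN n (le_of_max_le_left hNn)))⟩
  obtain ⟨N, hN⟩ := htail 1
  have hc1 : min (1 / 16) (1 / ((N : ℝ) + 1) ^ 3) ≤ 1 / 16 := min_le_left _ _
  have hc2 : min (1 / 16) (1 / ((N : ℝ) + 1) ^ 3) ≤ 1 / ((N : ℝ) + 1) ^ 3 := min_le_right _ _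
  -- For `n ≥ N` the tail bound with `A = 1` gives failure probability at most 1/2, whence an
  -- expectation of at least half of the 1/8 bound. For `n < N` the second term keeps the claim
  -- below 1, and at least one step is needed.
  refine ⟨min (1 / 16) (1 / ((N : ℝ) + 1) ^ 3), by positivity, fun n hn => ?_, fun A _ => ?_⟩
  · have hprob : IsProbabilityMeasure (harmonicLaw n hn) := by
      unfold harmonicLaw sorterLaw; infer_instance
    have hn2 : (2 : ℝ) ≤ n := by exact_mod_cast hn
    rcases le_or_gt N n with hNn | hNn
    · set B := ENNReal.ofReal (1 / 8 * (n * Real.log n ^ 2)) with hB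
      set S := {ω | (sortingTime (pairFlipPerm n) ω : ℝ≥0∞) ≤ B} with hS
      have h1 : harmonicLaw n hn S ≤ 2⁻¹ := by
        refine (hN n hn hNn).trans ?_
        rw [Real.rpow_neg_one]
        refine (ENNReal.ofReal_le_ofReal (inv_anti₀ (by norm_num) hn2)).trans (le_of_eq ?_)
        rw [ENNReal.ofReal_inv_of_pos (by norm_num)]
        simp
      have h2 : 2⁻¹ ≤ harmonicLaw n hn Sᶜ := by
        have h3 : (1 : ℝ≥0∞) ≤ harmonicLaw n hn S + harmonicLaw n hn Sᶜ := by
          rw [← measure_univ (μ := harmonicLaw n hn), ← Set.union_compl_self S]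
          exact measure_union_le _ _
        have h4 : (1 : ℝ≥0∞) ≤ 2⁻¹ + harmonicLaw n hn Sᶜ := h3.trans (by gcongr)
        rw [← ENNReal.inv_two_add_inv_two] at h4
        exact (ENNReal.add_le_add_iff_left (by simp)).1 h4
      calc ENNReal.ofReal (min (1 / 16) (1 / ((N : ℝ) + 1) ^ 3) * (n * Real.log n ^ 2))
          ≤ ENNReal.ofReal ((1 / 8 * (n * Real.log n ^ 2)) * 2⁻¹) := by
            refine ENNReal.ofReal_le_ofReal ?_
            have := mul_le_mul_of_nonneg_right hc1
              (by positivity : (0 : ℝ) ≤ n * Real.log n ^ 2)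
            linarith
        _ = B * 2⁻¹ := by
            rw [ENNReal.ofReal_mul (by positivity), ENNReal.ofReal_inv_of_pos (by norm_num)]
            simp [hB]
        _ ≤ B * harmonicLaw n hn Sᶜ := mul_le_mul_right h2 B
        _ ≤ B * harmonicLaw n hn {ω | B ≤ (sortingTime (pairFlipPerm n) ω : ℝ≥0∞)} := by
            gcongr
            intro ω hω
            rw [hS, Set.mem_compl_iff, Set.mem_ofPred_eq, not_le] at hω
            exact hω.le
        _ ≤ _ := mul_meas_ge_le_lintegral₀ (measurable_sortingTime _).aemeasurable B
    · calc ENNReal.ofReal (min (1 / 16) (1 / ((N : ℝ) + 1) ^ 3) * (n * Real.log n ^ 2))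
          ≤ ENNReal.ofReal 1 := by
            refine ENNReal.ofReal_le_ofReal ?_
            have h1 : Real.log n ≤ n := Real.log_le_self (by linarith)
            have h2 : 0 ≤ Real.log n := Real.log_natCast_nonneg n
            have h3 : (n : ℝ) ≤ N + 1 := by exact_mod_cast (by omega : n ≤ N + 1)
            have h4 : n * Real.log n ^ 2 ≤ ((N : ℝ) + 1) ^ 3 := by
              calc n * Real.log n ^ 2 ≤ (n : ℝ) * n ^ 2 := by gcongr
                _ = (n : ℝ) ^ 3 := by ring
                _ ≤ _ := by gcongr
            refine (mul_le_mul hc2 h4 (by positivity) (by positivity)).trans (le_of_eq ?_)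
            field_simp
        _ = ∫⁻ _, 1 ∂(harmonicLaw n hn) := by simp
        _ ≤ _ := lintegral_mono fun ω => by
            rw [← ENat.toENNReal_one, ENat.toENNReal_le]
            exact one_le_sortingTime_pairFlipPerm hn ω
  · obtain ⟨n₀, h⟩ := htail A
    refine ⟨n₀, fun n hn hn₀ => (measure_mono fun ω hω => ?_).trans (h n hn hn₀)⟩
    refine le_trans hω (ENNReal.ofReal_le_ofReal ?_)
    exact mul_le_mul_of_nonneg_right (hc1.trans (by norm_num)) (by positivity)

end Bounds

end RandomSorter

theorem mainTheorem2 :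
    -- upper bound in expectation, for every list
    (∃ K : ℝ, 0 < K ∧ ∀ (n : ℕ) (hn : 2 ≤ n) (α : Type*) [LinearOrder α] (x : Fin n → α),
      ∫⁻ ω, (RandomSorter.sortingTime x ω : ℝ≥0∞) ∂(RandomSorter.harmonicLaw n hn)
        ≤ ENNReal.ofReal (K * (n * Real.log n ^ 2))) ∧
    -- upper bound with polynomially small failure probability, for every list
    (∀ A : ℝ, 0 < A → ∃ K : ℝ, 0 < K ∧
      ∀ (n : ℕ) (hn : 2 ≤ n) (α : Type*) [LinearOrder α] (x : Fin n → α),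
        RandomSorter.harmonicLaw n hn
            {ω | ENNReal.ofReal (K * (n * Real.log n ^ 2))
              < (RandomSorter.sortingTime x ω : ℝ≥0∞)}
          ≤ ENNReal.ofReal ((n : ℝ) ^ (-A))) ∧
    -- lower bounds, in both senses, for some permutation of each length
    (∃ c : ℝ, 0 < c ∧ ∃ x : (n : ℕ) → Equiv.Perm (Fin n),
      (∀ (n : ℕ) (hn : 2 ≤ n),
        ENNReal.ofReal (c * (n * Real.log n ^ 2))
          ≤ ∫⁻ ω, (RandomSorter.sortingTime (x n) ω : ℝ≥0∞) ∂(RandomSorter.harmonicLaw n hn)) ∧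
      (∀ A : ℝ, 0 < A → ∃ n₀ : ℕ, ∀ (n : ℕ) (hn : 2 ≤ n), n₀ ≤ n →
        RandomSorter.harmonicLaw n hn
            {ω | (RandomSorter.sortingTime (x n) ω : ℝ≥0∞)
              ≤ ENNReal.ofReal (c * (n * Real.log n ^ 2))}
          ≤ ENNReal.ofReal ((n : ℝ) ^ (-A)))) := by
  refine ⟨⟨15, by norm_num, fun n hn α _ x => RandomSorter.lintegral_sortingTime_le_log hn x⟩,
    fun A hA => ⟨5 / 2 * (A + 5), by positivity, fun n hn α _ x =>
      RandomSorter.measure_sortingTime_gt_le hn x hA⟩, ?_⟩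
  obtain ⟨c, hc, h1, h2⟩ := RandomSorter.exists_lower_bound
  exact ⟨c, hc, RandomSorter.pairFlipPerm, h1, h2⟩
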